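/- Let $f_0:\mathbb R^d\to\mathbb R$ be differentiable, $A\in\mathbb R^{n\times d}$, $b\in\mathbb R^n$, $\bar A\in\mathbb R^{\bar n\times d}$, $\bar b\in\mathbb R^{\bar n}$, $\bar g:\mathbb R^{\bar n}\to\mathbb R\cup\{+\infty\}$, and consider $$\min_{x\in\mathbb R^d} F_0(x):=f_0(x)+g(x)\quad\text{s.t. } Ax+b=0,\qquad g(x):=\bar g(\bar A x+\bar b).$$ The instance belongs to *Problem Class 1* (with constant $L_f>0$) if (i) $\inf_x F_0(x)>-\infty$; (ii) $\|\nabla f_0(x)-\nabla f_0(x')\|\le L_f\|x-x'\|$ for all $x,x'$; (iii) $g$ and $\bar g$ are proper, lower semicontinuous and convex, the relative interior of $\operatorname{dom}\bar g$ is nonempty and $\operatorname{dom}\bar g$ is not a singleton. A point $x$ is *$\epsilon$-stationary* if for some $\gamma\in\mathbb R^n$ one has $\operatorname{dist}(0,\nabla f_0(x)+A^\top\gamma+\partial g(x))\le\epsilon$ and $\|Ax+b\|\le\epsilon$. For $A\ne0$, $\kappa(A):=\sqrt{\lambda_{\max}(AA^\top)/\lambda^+_{\min}(AA^\top)}$,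 where $\lambda^+_{\min}$ denotes the smallest positive eigenvalue. For a starting point $x^{(0)}$, $\Delta_{F_0}:=F_0(x^{(0)})-\inf_x F_0(x)$. The proximal mapping is $\operatorname{prox}_{\eta g}(x)=\arg\min_{x'}\{g(x')+\frac1{2\eta}\|x'-x\|^2\}$, and $\mathrm{ORACLE}_1(x,z,\eta)$, for $x\in\mathbb R^d$, $z\in\mathbb R^n$, $\eta>0$, returns $(\nabla f_0(x),Ax,A^\top z,\operatorname{prox}_{\eta g}(x))$. A first-order method (FOM) in *Algorithm Class 1* started at $x^{(0)}$ generates $x^{(1)},x^{(2)},\dots$ such that for every $t\ge1$ there are $\eta_t>0$ and $\xi^{(t)}\in\operatorname{span}\{x^{(s)},\nabla f_0(x^{(s)}),A^\top b,A^\top Ax^{(s)}: 0\le s<t\}$ with $x^{(t)}\in\operatorname{span}\{\xi^{(t)},\operatorname{prox}_{\eta_t g}(\xi^{(t)})\}$. **Claim.** Let $\epsilon>0$, $L_f>0$, $C>1$ and $D\in\mathbb R$. There is a dimension $d$ such that for every starting point $x^{(0)}\in\mathbb R^d$ there is an instance in Problem Class 1 with constant $L_f$ in $\mathbb R^d$ such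 that $g$ is non-smooth (not a real-valued everywhere differentiable function), $A\neq0$, $x^{(0)}$ is feasible with $F_0(x^{(0)})<+\infty$, $\Delta_{F_0}\ge D$, an $\epsilon$-stationary point exists, and every FOM in Algorithm Class 1 started at $x^{(0)}$ needs at least $$N:=\left\lceil C\,\kappa(A)\,L_f\,\Delta_{F_0}\,\epsilon^{-2}\right\rceil$$ calls to $\mathrm{ORACLE}_1$ to produce an $\epsilon$-stationary point of the instance. Precisely, if an iterate $x^{(t)}$ of such an FOM is $\epsilon$-stationary, then $t\ge N$ (one call counted per update), and also $k\ge N$ whenever $x^{(t)}$ lies in the span of $x^{(0)}$ and of the $\mathbb R^d$-vectors $\nabla f_0(x_i),A^\top z_i,\operatorname{prox}_{\eta_i g}(x_i)$ returned by $k$ successive calls $\mathrm{ORACLE}_1(x_i,z_i,\eta_i)$, $i=1,\dots,k$, in which $x_i$ lies in the span $V_{i-1}$ of $x^{(0)}$ and of the $\mathbb R^d$-vectors returned by the previous calls, and $z_i$ lies in the span of $b$ and $A V_{i-1}$. -/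

import Mathlib

noncomputable section

/-- `ℝ^k` with the Euclidean norm. -/
abbrev Vec (k : ℕ) : Type := EuclideanSpace ℝ (Fin k)

/-- The matrix `M` acting on column vectors. -/
def matAct {k l : ℕ} (M : Matrix (Fin k) (Fin l) ℝ) (v : Vec l) : Vec k :=
  Matrix.toEuclideanLin M v

/-- Effective domain of an extended-real-valued function. -/
def effDom {k : ℕ} (h : Vec k → EReal) : Set (Vec k) := {y | h y < ⊤}

/-- A proper lower semicontinuous convex function `ℝ^k → ℝ ∪ {+∞}`
(convexity is convexity of the epigraph). -/
structure IsProperLscConvex {k : ℕ} (h : Vec k → EReal) : Prop where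
  ne_bot : ∀ y, h y ≠ ⊥
  exists_ne_top : ∃ y, h y ≠ ⊤
  lsc : LowerSemicontinuous h
  convex : Convex ℝ {p : Vec k × ℝ | h p.1 ≤ (p.2 : EReal)}

/-- The convex subdifferential `∂h(x)`. -/
def subdiff {k : ℕ} (h : Vec k → EReal) (x : Vec k) : Set (Vec k) :=
  {v | h x ≠ ⊤ ∧ ∀ y, h x + ((inner ℝ v (y - x) : ℝ) : EReal) ≤ h y}

/-- `p` is the proximal point `prox_{η h}(x)`, that is, a minimizer of
`x' ↦ h x' + ‖x' - x‖² / (2 η)`. -/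
def IsProx {k : ℕ} (h : Vec k → EReal) (η : ℝ) (x p : Vec k) : Prop :=
  ∀ x', h p + ((1 / (2 * η) * ‖p - x‖ ^ 2 : ℝ) : EReal)
    ≤ h x' + ((1 / (2 * η) * ‖x' - x‖ ^ 2 : ℝ) : EReal)

/-- `κ(M) = √(λ_max(M Mᵀ) / λ_min⁺(M Mᵀ))`, with `λ_max` the largest and `λ_min⁺` the smallest
positive eigenvalue; it is meant for `M ≠ 0`. -/
def condNumber {k l : ℕ} (M : Matrix (Fin k) (Fin l) ℝ) : ℝ :=
  Real.sqrt (sSup (spectrum ℝ (M * M.transpose)) /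
    sInf {μ : ℝ | μ ∈ spectrum ℝ (M * M.transpose) ∧ 0 < μ})

/-- Data of the problem `min f₀(x) + g(x)` subject to `A x + b = 0`, where
`g(x) = gbar (Abar x + bbar)`. -/
structure CompositeProblem (d n nbar : ℕ) where
  f₀ : Vec d → ℝ
  A : Matrix (Fin n) (Fin d) ℝ
  b : Vec n
  gbar : Vec nbar → EReal
  Abar : Matrix (Fin nbar) (Fin d) ℝ
  bbar : Vec nbar

/-- A query `(x, z, η)` to the first-order oracle. -/
structure OracleQuery (d n : ℕ) where
  x : Vec d
  z : Vec n
  η : ℝ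
  η_pos : 0 < η

/-- An answer of the first-order oracle: values for `∇f₀(x)`, `A x`, `Aᵀ z`, `prox_{η g}(x)`. -/
structure OracleAnswer (d n : ℕ) where
  grad : Vec d
  Ax : Vec n
  Atz : Vec d
  prox : Vec d

namespace CompositeProblem

variable {d n nbar : ℕ}

/-- The regularizer `g(x) = gbar (Abar x + bbar)`. -/
def g (P : CompositeProblem d n nbar) (x : Vec d) : EReal := P.gbar (matAct P.Abar x + P.bbar)

/-- The objective `F₀ = f₀ + g`. -/
def F₀ (P : CompositeProblem d n nbar) (x : Vec d) : EReal := (P.f₀ x : EReal) + P.g x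

/-- `Δ_{F₀} = F₀(x⁰) - inf F₀`, meant for `F₀(x⁰) < +∞` and `inf F₀ > -∞`. -/
def gap (P : CompositeProblem d n nbar) (x0 : Vec d) : ℝ := (P.F₀ x0 - ⨅ x, P.F₀ x).toReal

/-- The problem class with smoothness constant `Lf`. -/
structure InProblemClass (P : CompositeProblem d n nbar) (Lf : ℝ) : Prop where
  bounded_below : ⊥ < ⨅ x, P.F₀ x
  differentiable : Differentiable ℝ P.f₀
  smooth : ∀ x x', ‖gradient P.f₀ x - gradient P.f₀ x'‖ ≤ Lf * ‖x - x'‖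
  g_proper : IsProperLscConvex P.g
  gbar_proper : IsProperLscConvex P.gbar
  relint_dom : (intrinsicInterior ℝ (effDom P.gbar)).Nonempty
  dom_not_singleton : ¬ ∃ y, effDom P.gbar = {y}

/-- The regularizer is non-smooth: it is not a real-valued function differentiable everywhere. -/
def NonsmoothRegularizer (P : CompositeProblem d n nbar) : Prop :=
  ¬ ∃ h : Vec d → ℝ, Differentiable ℝ h ∧ ∀ x, P.g x = (h x : EReal)

/-- `x` is an `ε`-stationary point: for some multiplier `γ`,
`dist(0, ∇f₀(x) + Aᵀ γ + ∂g(x)) ≤ ε` and `‖A x + b‖ ≤ ε`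
(the distance to the empty set is `+∞`). -/
def IsEpsStationary (P : CompositeProblem d n nbar) (ε : ℝ) (x : Vec d) : Prop :=
  ∃ γ : Vec n,
    Metric.infEDist 0
      ((fun v => gradient P.f₀ x + matAct P.A.transpose γ + v) '' subdiff P.g x)
        ≤ ENNReal.ofReal ε ∧
    ‖matAct P.A x + P.b‖ ≤ ε

/-- The first-order oracle: `a` is the answer to the query `q`. -/
structure IsOracleAnswer (P : CompositeProblem d n nbar) (q : OracleQuery d n)
    (a : OracleAnswer d n) : Prop where
  grad_eq : a.grad = gradient P.f₀ q.x
  Ax_eq : a.Ax = matAct P.A q.x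
  Atz_eq : a.Atz = matAct P.A.transpose q.z
  prox_spec : IsProx P.g q.η q.x a.prox

/-- The iterates `x⁰, x¹, …` follow the rule of the algorithm class: for `t ≥ 1`,
`xᵗ ∈ span {ξᵗ, prox_{η_t g}(ξᵗ)}` with `η_t > 0` and
`ξᵗ ∈ span {xˢ, ∇f₀(xˢ), Aᵀ b, Aᵀ A xˢ : s < t}`. -/
def IsFOM (P : CompositeProblem d n nbar) (x : ℕ → Vec d) : Prop :=
  ∀ t, 1 ≤ t → ∃ (η : ℝ) (ξ p : Vec d), 0 < η ∧
    ξ ∈ Submodule.span ℝ {v : Vec d | ∃ s < t, v = x s ∨ v = gradient P.f₀ (x s) ∨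
      v = matAct P.A.transpose P.b ∨ v = matAct P.A.transpose (matAct P.A (x s))} ∧
    IsProx P.g η ξ p ∧
    x t ∈ Submodule.span ℝ {ξ, p}

/-- Span of the starting point and of all vectors of `ℝ^d` returned by the calls
number `0, …, k - 1`. -/
def knownSpan (x0 : Vec d) (a : ℕ → OracleAnswer d n) (k : ℕ) : Submodule ℝ (Vec d) :=
  Submodule.span ℝ ({x0} ∪ {v | ∃ i < k, v = (a i).grad ∨ v = (a i).Atz ∨ v = (a i).prox})

/-- `q 0, …, q (k - 1)` are `k` successive oracle calls, with answers `a 0, …, a (k - 1)`, that a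
method started at `x0` can make: each query point `x` is a linear combination of the vectors
already known, and each query point `z` one of `b` and of the images under `A` of such vectors. -/
def IsCallSequence (P : CompositeProblem d n nbar) (x0 : Vec d) (k : ℕ)
    (q : ℕ → OracleQuery d n) (a : ℕ → OracleAnswer d n) : Prop :=
  ∀ i < k, P.IsOracleAnswer (q i) (a i) ∧
    (q i).x ∈ knownSpan x0 a i ∧
    (q i).z ∈ Submodule.span ℝ ({P.b} ∪ matAct P.A '' (knownSpan x0 a i : Set (Vec d)))

/-- Started at `x0`, the point `y` can be produced from `k` calls to the oracle. -/
def ProducibleWith (P : CompositeProblem d n nbar) (x0 : Vec d) (k : ℕ) (y : Vec d) : Prop :=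
  ∃ (q : ℕ → OracleQuery d n) (a : ℕ → OracleAnswer d n),
    P.IsCallSequence x0 k q a ∧ y ∈ knownSpan x0 a k

end CompositeProblem

end

open CompositeProblem

/-! The instance is a chain of `2 p` orthonormal coordinates orthogonal to `x0`. The matrix ties
coordinates `2 j` and `2 j + 1`, the regularizer ties `2 j + 1` and `2 j + 2`, and the loss pulls
only the first `p` coordinates towards `c`. Neither coupling alone is long or ill-conditioned, so
`κ(A) = 1`; the length of the chain comes from alternating the two.

Slow progress: gradients reach only the first `p` coordinates, `Aᵀ A` passes at most one coordinate
further, and the prox passes no odd boundary (`prox_mem_vanishFrom`). Since `p` is odd, each call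
advances the front by at most two (`iterate_mem_vanishFrom`, `knownSpan_le_vanishFrom`).

No early stationarity: if the last coordinate is zero, near-feasibility carries smallness back along
the chain (`abs_inner_le`), so every coordinate is at most `c / 2`. The all-ones vector is
orthogonal to all `Aᵀ γ` and to `∂g`, so testing against it shows that the gradient cannot be
cancelled (`not_isEpsStationary`).

With `c = K / √p` the gap is `Lf K² / 2` for every `p`. Hence the target `N` is fixed before `p`,
and the chain can be made as long as needed. -/

/-! ### Orthonormal coordinates orthogonal to the starting point. -/

/-- The vectors `w 0, …, w (m - 1)` are orthonormal. -/
def OrthonormalBelow {d : ℕ} (w : ℕ → Vec d) (m : ℕ) : Prop :=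
  ∀ i < m, ∀ j < m, inner ℝ (w i) (w j) = if i = j then (1 : ℝ) else 0

/-- One dimension beyond `m` suffices because `x0` spans at most a line; hence the dimension can be
fixed before `x0` is given. -/
theorem exists_orthonormalBelow_orthogonal {m d : ℕ} (hd : m + 1 = d) (x0 : Vec d) :
    ∃ w : ℕ → Vec d, OrthonormalBelow w m ∧ ∀ i < m, inner ℝ (w i) x0 = (0 : ℝ) := by
  have hfin : m ≤ Module.finrank ℝ (Submodule.span ℝ {x0} : Submodule ℝ (Vec d))ᗮ := by
    have h1 := Submodule.finrank_add_finrank_orthogonal (Submodule.span ℝ {x0})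
    have h2 : Module.finrank ℝ (Submodule.span ℝ {x0}) ≤ 1 := by
      simpa using finrank_span_le_card (R := ℝ) ({x0} : Set (Vec d))
    simp only [finrank_euclideanSpace, Fintype.card_fin] at h1
    omega
  let e := stdOrthonormalBasis ℝ (Submodule.span ℝ {x0} : Submodule ℝ (Vec d))ᗮ
  refine ⟨fun i => if h : i < m then (e ⟨i, h.trans_le hfin⟩ : Vec d) else 0, ?_, ?_⟩
  · intro i hi j hj
    have h := orthonormal_iff_ite.mp e.orthonormal ⟨i, hi.trans_le hfin⟩ ⟨j, hj.trans_le hfin⟩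
    simpa [hi, hj] using h
  · intro i hi
    have h := (e ⟨i, hi.trans_le hfin⟩).2
    rw [Submodule.mem_orthogonal_singleton_iff_inner_left] at h
    simpa [hi] using h

theorem OrthonormalBelow.inner_sum_smul {d m : ℕ} {w : ℕ → Vec d} (hw : OrthonormalBelow w m)
    {s : Finset ℕ} (hs : ∀ i ∈ s, i < m) (a : ℕ → ℝ) {i : ℕ} (hi : i < m) :
    inner ℝ (w i) (∑ j ∈ s, a j • w j) = if i ∈ s then a i else 0 := by
  rw [inner_sum, ← Finset.sum_ite_eq s i a]
  refine Finset.sum_congr rfl fun j hj => ?_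
  rw [inner_smul_right, hw i hi j (hs j hj)]
  split_ifs <;> simp

/-- Bessel's inequality; it gives the Lipschitz constant of the gradient. -/
theorem OrthonormalBelow.norm_sum_inner_smul_le {d m : ℕ} {w : ℕ → Vec d}
    (hw : OrthonormalBelow w m) {s : Finset ℕ} (hs : ∀ i ∈ s, i < m) (z : Vec d) :
    ‖∑ i ∈ s, (inner ℝ (w i) z : ℝ) • w i‖ ≤ ‖z‖ := by
  set q := ∑ i ∈ s, (inner ℝ (w i) z : ℝ) • w i with hq
  have h1 : inner ℝ q q = (inner ℝ q z : ℝ) := by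
    conv_lhs => arg 2; rw [hq]
    conv_rhs => rw [hq]
    rw [sum_inner, sum_inner]
    refine Finset.sum_congr rfl fun i hi => ?_
    rw [inner_smul_left, inner_smul_left, hq, hw.inner_sum_smul hs _ (hs i hi), if_pos hi]
  have h2 := real_inner_le_norm q z
  rw [← h1, real_inner_self_eq_norm_sq] at h2
  by_contra! h
  nlinarith [norm_nonneg z]

/-- The sum of the first `m` vectors. -/
def chainOnes {d : ℕ} (w : ℕ → Vec d) (m : ℕ) : Vec d := ∑ i ∈ Finset.range m, w i

theorem OrthonormalBelow.inner_chainOnes {d m : ℕ} {w : ℕ → Vec d} (hw : OrthonormalBelow w m)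
    {i : ℕ} (hi : i < m) : inner ℝ (w i) (chainOnes w m) = (1 : ℝ) := by
  have h := hw.inner_sum_smul (s := Finset.range m) (by simp) (fun _ => 1) hi
  simpa [chainOnes, hi] using h

theorem OrthonormalBelow.norm_sq_chainOnes {d m : ℕ} {w : ℕ → Vec d}
    (hw : OrthonormalBelow w m) : ‖chainOnes w m‖ ^ 2 = m := by
  rw [← real_inner_self_eq_norm_sq]
  conv_lhs => arg 2; rw [chainOnes]
  rw [sum_inner, Finset.sum_congr rfl fun i hi => hw.inner_chainOnes (Finset.mem_range.mp hi)]
  simp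

/-! ### The filtration measuring progress, and the linked subspace. -/

/-- The vectors whose coordinates along `w k, …, w (m - 1)` vanish. -/
def vanishFrom {d : ℕ} (w : ℕ → Vec d) (m k : ℕ) : Submodule ℝ (Vec d) where
  carrier := {x | ∀ i < m, k ≤ i → inner ℝ (w i) x = (0 : ℝ)}
  zero_mem' := by simp
  add_mem' := by
    intro x y hx hy i hi hk
    rw [inner_add_right, hx i hi hk, hy i hi hk, add_zero]
  smul_mem' := by
    intro a x hx i hi hk
    rw [inner_smul_right, hx i hi hk, mul_zero]

theorem vanishFrom_mono {d : ℕ} (w : ℕ → Vec d) (m : ℕ) {k l : ℕ} (h : k ≤ l) :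
    vanishFrom w m k ≤ vanishFrom w m l :=
  fun _ hx i hi hl => hx i hi (h.trans hl)

/-- The vectors whose coordinates number `2 j + 1` and `2 j + 2` agree. -/
def linkSpace {d : ℕ} (w : ℕ → Vec d) (m : ℕ) : Submodule ℝ (Vec d) where
  carrier := {x | ∀ j, 2 * j + 2 < m → inner ℝ (w (2 * j + 1)) x = (inner ℝ (w (2 * j + 2)) x : ℝ)}
  zero_mem' := by simp
  add_mem' := by
    intro x y hx hy j hj
    rw [inner_add_right, inner_add_right, hx j hj, hy j hj]
  smul_mem' := by
    intro a x hx j hj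
    rw [inner_smul_right, inner_smul_right, hx j hj]

/-! ### Indicators of subspaces: convexity, subgradients, prox. -/

open Classical in
/-- The indicator function of a set. -/
noncomputable def indicatorE {d : ℕ} (S : Set (Vec d)) (x : Vec d) : EReal := if x ∈ S then 0 else ⊤

theorem indicatorE_of_mem {d : ℕ} {S : Set (Vec d)} {x : Vec d} (h : x ∈ S) :
    indicatorE S x = 0 := if_pos h

theorem indicatorE_of_notMem {d : ℕ} {S : Set (Vec d)} {x : Vec d} (h : x ∉ S) :
    indicatorE S x = ⊤ := if_neg h

theorem indicatorE_nonneg {d : ℕ} (S : Set (Vec d)) (x : Vec d) : 0 ≤ indicatorE S x := by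
  unfold indicatorE
  split_ifs <;> simp

theorem mem_of_indicatorE_lt_top {d : ℕ} {S : Set (Vec d)} {x : Vec d}
    (h : indicatorE S x ≠ ⊤) : x ∈ S := by
  by_contra hx
  exact h (indicatorE_of_notMem hx)

theorem effDom_indicatorE {d : ℕ} (S : Set (Vec d)) : effDom (indicatorE S) = S := by
  ext x
  constructor
  · exact fun h => mem_of_indicatorE_lt_top (ne_of_lt h)
  · intro h
    simp [effDom, indicatorE_of_mem h]

theorem isProperLscConvex_indicatorE {d : ℕ} (S : Submodule ℝ (Vec d)) :
    IsProperLscConvex (indicatorE (S : Set (Vec d))) where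
  ne_bot y := by
    have h := indicatorE_nonneg (S : Set (Vec d)) y
    intro h'
    simp [h'] at h
  exists_ne_top := ⟨0, by simp [indicatorE_of_mem (S.zero_mem)]⟩
  lsc := by
    rw [lowerSemicontinuous_iff_isClosed_preimage]
    intro y
    by_cases hy : y = ⊤
    · simp [hy]
    by_cases h0 : 0 ≤ y
    · have : indicatorE (S : Set (Vec d)) ⁻¹' Set.Iic y = S := by
        ext x
        by_cases hx : x ∈ (S : Set (Vec d))
        · simp [indicatorE_of_mem hx, h0, SetLike.mem_coe.mp hx]
        · simpa [indicatorE_of_notMem hx, hy] using hx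
      rw [this]
      exact S.closed_of_finiteDimensional
    · have : indicatorE (S : Set (Vec d)) ⁻¹' Set.Iic y = ∅ := by
        ext x
        simpa using (not_le.mp h0).trans_le (indicatorE_nonneg _ x)
      rw [this]
      exact isClosed_empty
  convex := by
    have : {p : Vec d × ℝ | indicatorE (S : Set (Vec d)) p.1 ≤ (p.2 : EReal)} =
        (S : Set (Vec d)) ×ˢ Set.Ici (0 : ℝ) := by
      ext ⟨x, t⟩
      by_cases hx : x ∈ (S : Set (Vec d))
      · simp [indicatorE_of_mem hx, SetLike.mem_coe.mp hx]
      · simpa [indicatorE_of_notMem hx] using fun h : x ∈ S => absurd h hx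
    rw [this]
    exact S.convex.prod (convex_Ici 0)

/-- The subgradient inequality can be tested at both `x + u` and `x - u`. -/
theorem inner_eq_zero_of_mem_subdiff_indicatorE {d : ℕ} {S : Submodule ℝ (Vec d)}
    {x u v : Vec d} (hv : v ∈ subdiff (indicatorE (S : Set (Vec d))) x) (hu : u ∈ S) :
    inner ℝ v u = (0 : ℝ) := by
  obtain ⟨hx, hv⟩ := hv
  have hx : x ∈ (S : Set (Vec d)) := mem_of_indicatorE_lt_top hx
  have key : ∀ u ∈ S, inner ℝ v u ≤ (0 : ℝ) := by
    intro u hu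
    have h := hv (x + u)
    rw [indicatorE_of_mem hx, indicatorE_of_mem (S.add_mem hx hu), add_sub_cancel_left,
      zero_add] at h
    exact_mod_cast h
  have h1 := key u hu
  have h2 := key (-u) (S.neg_mem hu)
  rw [inner_neg_right] at h2
  linarith

theorem IsProx.mem_and_norm_le {d : ℕ} {S : Submodule ℝ (Vec d)} {η : ℝ} (hη : 0 < η)
    {x p : Vec d} (h : IsProx (indicatorE (S : Set (Vec d))) η x p) :
    p ∈ S ∧ ∀ y ∈ S, ‖p - x‖ ^ 2 ≤ ‖y - x‖ ^ 2 := by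
  have hp : p ∈ (S : Set (Vec d)) := by
    by_contra hp
    have h0 := h 0
    rw [indicatorE_of_notMem hp, indicatorE_of_mem S.zero_mem, EReal.top_add_coe, zero_add] at h0
    exact absurd h0 (not_le.mpr (EReal.coe_lt_top _))
  refine ⟨hp, fun y hy => ?_⟩
  have h1 := h y
  rw [indicatorE_of_mem hp, indicatorE_of_mem hy, zero_add, zero_add,
    EReal.coe_le_coe_iff] at h1
  exact le_of_mul_le_mul_left h1 (by positivity)

/-- Dropping the tail `q` of the prox point stays in the subspace and, as `q` is orthogonal to `x`,
lowers the squared distance by `‖q‖²`. Minimality forces `q = 0`. -/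
theorem OrthonormalBelow.prox_mem_vanishFrom {d m k : ℕ} {w : ℕ → Vec d}
    (hw : OrthonormalBelow w m) (hk : Odd k) {η : ℝ} (hη : 0 < η) {x p : Vec d}
    (hx : x ∈ vanishFrom w m k)
    (h : IsProx (indicatorE (linkSpace w m : Set (Vec d))) η x p) : p ∈ vanishFrom w m k := by
  obtain ⟨hp, hmin⟩ := h.mem_and_norm_le hη
  have hs : ∀ i ∈ Finset.Ico k m, i < m := fun i hi => (Finset.mem_Ico.mp hi).2
  set q := ∑ i ∈ Finset.Ico k m, (inner ℝ (w i) p : ℝ) • w i with hq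
  have hwq : ∀ i < m, inner ℝ (w i) q = if k ≤ i then (inner ℝ (w i) p : ℝ) else 0 := by
    intro i hi
    rw [hq, hw.inner_sum_smul hs _ hi]
    simp [hi]
  -- Linked pairs start at odd indices, so none straddles the odd cut `k`.
  have hS : p - q ∈ linkSpace w m := by
    intro j hj
    rw [inner_sub_right, inner_sub_right, hwq _ (by omega), hwq _ hj]
    have h1 := hp j hj
    obtain ⟨l, rfl⟩ := hk
    by_cases hl : l ≤ j
    · rw [if_pos (by omega), if_pos (by omega)]
      simp
    · rw [if_neg (by omega), if_neg (by omega), h1]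
  have hqx : inner ℝ q x = (0 : ℝ) := by
    rw [hq, sum_inner]
    refine Finset.sum_eq_zero fun i hi => ?_
    rw [inner_smul_left, hx i (hs i hi) (Finset.mem_Ico.mp hi).1, mul_zero]
  have hqq : inner ℝ q p = (inner ℝ q q : ℝ) := by
    conv_rhs => arg 2; rw [hq]
    conv_lhs => rw [hq]
    rw [sum_inner, sum_inner]
    refine Finset.sum_congr rfl fun i hi => ?_
    rw [inner_smul_left, inner_smul_left, hwq i (hs i hi), if_pos (Finset.mem_Ico.mp hi).1]
  have h1 := hmin _ hS
  have h2 : ‖p - q - x‖ ^ 2 = ‖p - x‖ ^ 2 - ‖q‖ ^ 2 := by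
    rw [sub_right_comm, norm_sub_sq_real, real_inner_comm, inner_sub_right, hqx, hqq,
      real_inner_self_eq_norm_sq]
    ring
  have hq0 : q = 0 := by
    rw [← norm_eq_zero]
    nlinarith [norm_nonneg q]
  intro i hi hki
  have h3 := hwq i hi
  rw [if_pos hki, hq0, inner_zero_right] at h3
  exact h3.symm

/-! ### The loss and the coupling matrix. -/

/-- The quadratic `(L / 2) ∑_{i < p} (⟨w i, x⟩ - c)²`. -/
noncomputable def chainLoss {d : ℕ} (w : ℕ → Vec d) (p : ℕ) (L c : ℝ) (x : Vec d) : ℝ :=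
  L / 2 * ∑ i ∈ Finset.range p, ((inner ℝ (w i) x : ℝ) - c) ^ 2

theorem hasGradientAt_chainLoss {d : ℕ} (w : ℕ → Vec d) (p : ℕ) (L c : ℝ) (x : Vec d) :
    HasGradientAt (chainLoss w p L c)
      (L • ∑ i ∈ Finset.range p, ((inner ℝ (w i) x : ℝ) - c) • w i) x := by
  rw [hasGradientAt_iff_hasFDerivAt]
  have h1 : ∀ i ∈ Finset.range p, HasFDerivAt (fun x : Vec d => ((inner ℝ (w i) x : ℝ) - c) ^ 2)
      ((2 * ((inner ℝ (w i) x : ℝ) - c)) • innerSL ℝ (w i)) x := by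
    intro i _
    have := ((innerSL ℝ (w i)).hasFDerivAt (x := x)).sub_const c |>.pow 2
    simpa using this
  have h2 := (HasFDerivAt.fun_sum h1).const_mul (L / 2)
  refine h2.congr_fderiv ?_
  ext y
  simp only [_root_.smul_apply, _root_.sum_apply, innerSL_apply_apply,
    smul_eq_mul, InnerProductSpace.toDual_apply_apply, inner_smul_left, sum_inner, Finset.mul_sum]
  refine Finset.sum_congr rfl fun i _ => ?_
  simp
  ring

/-- The matrix with rows `M (w (2 j) - w (2 j + 1))`, `j < p`. -/
noncomputable def pairMatrix {d : ℕ} (w : ℕ → Vec d) (p : ℕ) (M : ℝ) : Matrix (Fin p) (Fin d) ℝ :=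
  Matrix.of fun j k => M * (w (2 * j) k - w (2 * j + 1) k)

theorem matAct_pairMatrix_apply {d : ℕ} (w : ℕ → Vec d) (p : ℕ) (M : ℝ) (x : Vec d) (j : Fin p) :
    matAct (pairMatrix w p M) x j =
      M * ((inner ℝ (w (2 * j)) x : ℝ) - inner ℝ (w (2 * j + 1)) x) := by
  rw [← inner_sub_left]
  simp only [matAct, pairMatrix, Matrix.toLpLin_apply, Matrix.mulVec, dotProduct, Matrix.of_apply,
    PiLp.inner_apply, Finset.mul_sum]
  refine Finset.sum_congr rfl fun i _ => ?_
  simp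
  ring

theorem inner_matAct_transpose {k l : ℕ} (A : Matrix (Fin k) (Fin l) ℝ) (x : Vec l) (z : Vec k) :
    inner ℝ x (matAct A.transpose z) = (inner ℝ (matAct A x) z : ℝ) := by
  have h := LinearMap.adjoint_inner_right (Matrix.toEuclideanLin A) x z
  rw [← Matrix.toEuclideanLin_conjTranspose_eq_adjoint,
    Matrix.conjTranspose_eq_transpose_of_trivial] at h
  exact h

/-- The rows are orthogonal of equal length, so the condition number is 1 for every scale `M > 0`,
which leaves `M` free. -/
theorem OrthonormalBelow.pairMatrix_mul_transpose {d p : ℕ} {w : ℕ → Vec d}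
    (hw : OrthonormalBelow w (2 * p)) (M : ℝ) :
    pairMatrix w p M * (pairMatrix w p M).transpose =
      algebraMap ℝ (Matrix (Fin p) (Fin p) ℝ) (2 * M ^ 2) := by
  ext i j
  have h : (pairMatrix w p M * (pairMatrix w p M).transpose) i j =
      M ^ 2 * inner ℝ (w (2 * i) - w (2 * i + 1)) (w (2 * j) - w (2 * j + 1)) := by
    simp only [Matrix.mul_apply, Matrix.transpose_apply, pairMatrix, Matrix.of_apply,
      PiLp.inner_apply, Finset.mul_sum]
    refine Finset.sum_congr rfl fun i _ => ?_
    simp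
    ring
  have hi := i.2
  have hj := j.2
  rw [h, inner_sub_left, inner_sub_right, inner_sub_right, hw _ (by omega) _ (by omega),
    hw _ (by omega) _ (by omega), hw _ (by omega) _ (by omega), hw _ (by omega) _ (by omega),
    Matrix.algebraMap_matrix_apply, if_neg (show ¬ 2 * (i : ℕ) = 2 * (j : ℕ) + 1 by omega),
    if_neg (show ¬ 2 * (i : ℕ) + 1 = 2 * (j : ℕ) by omega)]
  by_cases hij : i = j
  · subst hij
    simp
    ring
  · have hij' : (i : ℕ) ≠ j := fun h => hij (Fin.ext h)
    rw [if_neg (by omega), if_neg (by omega), if_neg hij]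
    simp

theorem OrthonormalBelow.condNumber_pairMatrix {d p : ℕ} {w : ℕ → Vec d}
    (hw : OrthonormalBelow w (2 * p)) (hp : 0 < p) {M : ℝ} (hM : 0 < M) :
    condNumber (pairMatrix w p M) = 1 := by
  have : Nonempty (Fin p) := ⟨⟨0, hp⟩⟩
  have hpos : 0 < 2 * M ^ 2 := by positivity
  have hset : {μ : ℝ | μ ∈ ({2 * M ^ 2} : Set ℝ) ∧ 0 < μ} = {2 * M ^ 2} := by
    ext μ
    simp only [Set.mem_singleton_iff, Set.mem_ofPred_eq, and_iff_left_iff_imp]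
    rintro rfl
    exact hpos
  rw [condNumber, hw.pairMatrix_mul_transpose, spectrum.scalar_eq, hset, csSup_singleton,
    csInf_singleton, div_self hpos.ne', Real.sqrt_one]

theorem OrthonormalBelow.pairMatrix_ne_zero {d p : ℕ} {w : ℕ → Vec d}
    (hw : OrthonormalBelow w (2 * p)) (hp : 0 < p) {M : ℝ} (hM : 0 < M) :
    pairMatrix w p M ≠ 0 := by
  intro h
  have h1 := matAct_pairMatrix_apply w p M (w 0) ⟨0, hp⟩
  rw [h, hw _ (by simp; omega) _ (by omega), hw _ (by simp; omega) _ (by omega)] at h1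
  simp [matAct] at h1
  exact hM.ne h1

theorem OrthonormalBelow.inner_matAct_pairMatrix_transpose {d p : ℕ} {w : ℕ → Vec d}
    (hw : OrthonormalBelow w (2 * p)) (M : ℝ) (z : Vec p) {i : ℕ} (hi : i < 2 * p)
    (hz : z ⟨i / 2, by omega⟩ = 0) :
    inner ℝ (w i) (matAct (pairMatrix w p M).transpose z) = (0 : ℝ) := by
  rw [inner_matAct_transpose, PiLp.inner_apply]
  refine Finset.sum_eq_zero fun j _ => ?_
  by_cases hj : i / 2 = j
  · have : j = ⟨i / 2, by omega⟩ := Fin.ext hj.symm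
    rw [this, hz, inner_zero_right]
  · have hj' := j.2
    rw [matAct_pairMatrix_apply, hw _ (by omega) _ hi, hw _ (by omega) _ hi,
      if_neg (by omega), if_neg (by omega)]
    simp

/-- If `i ≥ k + 1`, both members of the pair containing `i` have index at least `k`, so the row `i /
2` gives zero. -/
theorem OrthonormalBelow.matAct_transpose_matAct_mem_vanishFrom {d p k : ℕ} {w : ℕ → Vec d}
    (hw : OrthonormalBelow w (2 * p)) (M : ℝ) {x : Vec d} (hx : x ∈ vanishFrom w (2 * p) k) :
    matAct (pairMatrix w p M).transpose (matAct (pairMatrix w p M) x) ∈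
      vanishFrom w (2 * p) (k + 1) := by
  intro i hi hk
  apply hw.inner_matAct_pairMatrix_transpose M _ hi
  rw [matAct_pairMatrix_apply, hx _ (by simp; omega) (by simp; omega),
    hx _ (by simp; omega) (by simp; omega)]
  simp

/-! ### The hard instance and its membership in the class. -/

/-- The problem that couples `2 p` coordinates in a chain: the matrix couples the coordinates
`2 j` and `2 j + 1`, the regularizer the coordinates `2 j + 1` and `2 j + 2`, and the loss
depends on the first `p` coordinates only. -/
noncomputable def chainProblem {d : ℕ} (w : ℕ → Vec d) (p : ℕ) (L c M : ℝ) : CompositeProblem d p d where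
  f₀ := chainLoss w p L c
  A := pairMatrix w p M
  b := 0
  gbar := indicatorE (linkSpace w (2 * p) : Set (Vec d))
  Abar := 1
  bbar := 0

section ChainProblem

variable {d p : ℕ} {w : ℕ → Vec d} {L c M : ℝ}

theorem chainProblem_g :
    (chainProblem w p L c M).g = indicatorE (linkSpace w (2 * p) : Set (Vec d)) := by
  funext x
  simp [g, chainProblem, matAct]

theorem gradient_chainProblem (x : Vec d) : gradient (chainProblem w p L c M).f₀ x =
    L • ∑ i ∈ Finset.range p, ((inner ℝ (w i) x : ℝ) - c) • w i :=
  (hasGradientAt_chainLoss w p L c x).gradient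

theorem chainProblem_F₀_nonneg (hL : 0 < L) (x : Vec d) : 0 ≤ (chainProblem w p L c M).F₀ x := by
  rw [F₀, chainProblem_g]
  refine add_nonneg ?_ (indicatorE_nonneg _ x)
  have : 0 ≤ chainLoss w p L c x :=
    mul_nonneg (by positivity) (Finset.sum_nonneg fun i _ => sq_nonneg _)
  exact_mod_cast this

theorem OrthonormalBelow.smul_chainOnes_mem_linkSpace {m : ℕ} (hw : OrthonormalBelow w m) (a : ℝ) :
    a • chainOnes w m ∈ linkSpace w m := by
  refine Submodule.smul_mem _ _ fun j hj => ?_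
  rw [hw.inner_chainOnes (by omega), hw.inner_chainOnes hj]

theorem OrthonormalBelow.chainProblem_F₀_chainOnes (hw : OrthonormalBelow w (2 * p)) :
    (chainProblem w p L c M).F₀ (c • chainOnes w (2 * p)) = 0 := by
  have h : chainLoss w p L c (c • chainOnes w (2 * p)) = 0 := by
    rw [chainLoss, Finset.sum_eq_zero, mul_zero]
    intro i hi
    rw [inner_smul_right, hw.inner_chainOnes (by have := Finset.mem_range.mp hi; omega)]
    simp
  rw [F₀, chainProblem_g, indicatorE_of_mem (hw.smul_chainOnes_mem_linkSpace c), add_zero]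
  exact_mod_cast h

theorem OrthonormalBelow.iInf_chainProblem_F₀ (hw : OrthonormalBelow w (2 * p)) (hL : 0 < L) :
    ⨅ x, (chainProblem w p L c M).F₀ x = 0 :=
  le_antisymm ((iInf_le _ _).trans_eq hw.chainProblem_F₀_chainOnes)
    (le_iInf fun x => chainProblem_F₀_nonneg hL x)

theorem chainProblem_F₀_of_orthogonal {x0 : Vec d}
    (hx0 : ∀ i < 2 * p, inner ℝ (w i) x0 = (0 : ℝ)) :
    (chainProblem w p L c M).F₀ x0 = ((L / 2 * (p * c ^ 2) : ℝ) : EReal) := by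
  have h : chainLoss w p L c x0 = L / 2 * (p * c ^ 2) := by
    rw [chainLoss, Finset.sum_congr rfl (g := fun _ => c ^ 2)]
    · simp
    · intro i hi
      rw [hx0 i (by have := Finset.mem_range.mp hi; omega)]
      ring
  have hmem : x0 ∈ (linkSpace w (2 * p) : Set (Vec d)) := by
    intro j hj
    rw [hx0 _ (by omega), hx0 _ hj]
  rw [F₀, chainProblem_g, indicatorE_of_mem hmem, add_zero, ← h]
  rfl

theorem OrthonormalBelow.chainProblem_gap (hw : OrthonormalBelow w (2 * p)) (hL : 0 < L)
    {x0 : Vec d} (hx0 : ∀ i < 2 * p, inner ℝ (w i) x0 = (0 : ℝ)) :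
    (chainProblem w p L c M).gap x0 = L / 2 * (p * c ^ 2) := by
  rw [gap, hw.iInf_chainProblem_F₀ hL, chainProblem_F₀_of_orthogonal hx0, sub_zero,
    EReal.toReal_coe]

theorem OrthonormalBelow.notMem_linkSpace (hw : OrthonormalBelow w (2 * p)) (hp : 2 ≤ p) :
    w 1 ∉ (linkSpace w (2 * p) : Set (Vec d)) := by
  intro h
  have h1 := h 0 (by omega)
  rw [hw _ (by omega) _ (by omega), hw _ (by omega) _ (by omega)] at h1
  simp at h1

theorem OrthonormalBelow.chainProblem_inProblemClass (hw : OrthonormalBelow w (2 * p))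
    (hp : 2 ≤ p) (hL : 0 < L) : (chainProblem w p L c M).InProblemClass L where
  bounded_below := by
    rw [hw.iInf_chainProblem_F₀ hL]
    exact EReal.bot_lt_zero
  differentiable x := (hasGradientAt_chainLoss w p L c x).differentiableAt
  smooth x y := by
    rw [gradient_chainProblem, gradient_chainProblem, ← smul_sub, ← Finset.sum_sub_distrib,
      norm_smul, Real.norm_of_nonneg hL.le]
    refine mul_le_mul_of_nonneg_left ?_ hL.le
    refine le_trans (le_of_eq ?_) (hw.norm_sum_inner_smul_le (s := Finset.range p)
      (fun i hi => by have := Finset.mem_range.mp hi; omega) (x - y))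
    congr 1
    refine Finset.sum_congr rfl fun i _ => ?_
    rw [← sub_smul, inner_sub_right, sub_sub_sub_cancel_right]
  g_proper := by
    rw [chainProblem_g]
    exact isProperLscConvex_indicatorE _
  gbar_proper := isProperLscConvex_indicatorE _
  relint_dom := by
    change (intrinsicInterior ℝ (effDom (indicatorE (linkSpace w (2 * p) : Set (Vec d))))).Nonempty
    rw [effDom_indicatorE, intrinsicInterior_nonempty (linkSpace w (2 * p)).convex]
    exact ⟨0, (linkSpace w (2 * p)).zero_mem⟩
  dom_not_singleton := by
    rintro ⟨y, hy⟩
    change effDom (indicatorE (linkSpace w (2 * p) : Set (Vec d))) = {y} at hy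
    rw [effDom_indicatorE] at hy
    have h0 : (0 : Vec d) ∈ ({y} : Set (Vec d)) := hy ▸ (linkSpace w (2 * p)).zero_mem
    have h1 : (1 : ℝ) • chainOnes w (2 * p) ∈ ({y} : Set (Vec d)) :=
      hy ▸ hw.smul_chainOnes_mem_linkSpace 1
    have h2 := hw.norm_sq_chainOnes
    rw [one_smul] at h1
    rw [Set.mem_singleton_iff.mp h1, ← Set.mem_singleton_iff.mp h0] at h2
    simp at h2
    omega

theorem OrthonormalBelow.chainProblem_nonsmoothRegularizer (hw : OrthonormalBelow w (2 * p))
    (hp : 2 ≤ p) : (chainProblem w p L c M).NonsmoothRegularizer := by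
  rintro ⟨h, -, hg⟩
  have h1 := hg (w 1)
  rw [chainProblem_g, indicatorE_of_notMem (hw.notMem_linkSpace hp)] at h1
  exact EReal.coe_ne_top _ h1.symm

theorem OrthonormalBelow.matAct_pairMatrix_chainOnes (hw : OrthonormalBelow w (2 * p)) (a : ℝ) :
    matAct (pairMatrix w p M) (a • chainOnes w (2 * p)) = 0 := by
  ext j
  have hj := j.2
  rw [matAct_pairMatrix_apply, inner_smul_right, inner_smul_right,
    hw.inner_chainOnes (by omega), hw.inner_chainOnes (by omega)]
  simp

theorem OrthonormalBelow.chainProblem_isEpsStationary (hw : OrthonormalBelow w (2 * p)) {ε : ℝ}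
    (hε : 0 < ε) : (chainProblem w p L c M).IsEpsStationary ε (c • chainOnes w (2 * p)) := by
  refine ⟨0, ?_, ?_⟩
  · refine (Metric.infEDist_le_edist_of_mem (y := 0) ?_).trans (by simp)
    refine ⟨0, ⟨?_, fun y => ?_⟩, ?_⟩
    · rw [chainProblem_g, indicatorE_of_mem (hw.smul_chainOnes_mem_linkSpace c)]
      simp
    · rw [chainProblem_g, indicatorE_of_mem (hw.smul_chainOnes_mem_linkSpace c), inner_zero_left]
      simpa using indicatorE_nonneg _ y
    · change gradient _ _ + _ + 0 = 0
      rw [gradient_chainProblem, Finset.sum_eq_zero]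
      · simp [matAct]
      · intro i hi
        rw [inner_smul_right, hw.inner_chainOnes (by have := Finset.mem_range.mp hi; omega)]
        simp
  · have h := hw.matAct_pairMatrix_chainOnes (M := M) c
    change ‖matAct (pairMatrix w p M) (c • chainOnes w (2 * p)) + 0‖ ≤ ε
    simp [h, hε.le]

/-! ### No stationarity while the last coordinate vanishes. -/

/-- Backward induction from the last coordinate: a link of the regularizer costs nothing, a row of
the matrix costs at most `ε / M`. -/
theorem OrthonormalBelow.abs_inner_le (hM : 0 < M) {ε : ℝ} {x : Vec d}
    (hS : x ∈ linkSpace w (2 * p)) (hA : ‖matAct (pairMatrix w p M) x‖ ≤ ε)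
    (hx : x ∈ vanishFrom w (2 * p) (2 * p - 1)) (k : ℕ) (hk : k < 2 * p) :
    |(inner ℝ (w (2 * p - 1 - k)) x : ℝ)| ≤ k * (ε / M) := by
  have hε : 0 ≤ ε / M := div_nonneg ((norm_nonneg _).trans hA) hM.le
  induction k with
  | zero => simp [hx (2 * p - 1) (by omega) le_rfl]
  | succ k ih =>
    have ih := ih (by omega)
    push_cast
    obtain ⟨i, hi⟩ : ∃ i, 2 * p - 1 - (k + 1) = i := ⟨_, rfl⟩
    have hi' : 2 * p - 1 - k = i + 1 := by omega
    rw [hi]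
    rw [hi'] at ih
    rcases Nat.even_or_odd' i with ⟨j, rfl | rfl⟩
    · have h1 := (PiLp.norm_apply_le (matAct (pairMatrix w p M) x) ⟨j, by omega⟩).trans hA
      rw [matAct_pairMatrix_apply, norm_mul, Real.norm_of_nonneg hM.le, mul_comm,
        ← le_div_iff₀ hM, Real.norm_eq_abs] at h1
      have h2 := abs_sub_abs_le_abs_sub (inner ℝ (w (2 * j)) x : ℝ) (inner ℝ (w (2 * j + 1)) x)
      simp only at h1
      linarith
    · rw [hS j (by omega)]
      linarith

theorem OrthonormalBelow.not_isEpsStationary (hw : OrthonormalBelow w (2 * p)) (hp : 0 < p)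
    (hL : 0 < L) {ε : ℝ} (hε : 0 < ε) (hM : 0 < M) (hMc : 2 * p * (ε / M) ≤ c / 2)
    (hcp : 8 * ε ≤ L * c * Real.sqrt p) {x : Vec d}
    (hx : x ∈ vanishFrom w (2 * p) (2 * p - 1)) :
    ¬ (chainProblem w p L c M).IsEpsStationary ε x := by
  rintro ⟨γ, hdist, hA⟩
  have hA : ‖matAct (pairMatrix w p M) x‖ ≤ ε := by
    change ‖matAct (pairMatrix w p M) x + 0‖ ≤ ε at hA
    simpa using hA
  -- Relaxing to `2 ε` yields an actual subgradient without attainment of the distance.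
  have hlt := hdist.trans_lt
    ((ENNReal.ofReal_lt_ofReal_iff (by positivity : 0 < 2 * ε)).mpr (by linarith : ε < 2 * ε))
  obtain ⟨_, ⟨v, hv, rfl⟩, hlt⟩ := Metric.infEDist_lt_iff.mp hlt
  rw [chainProblem_g] at hv
  have hS : x ∈ linkSpace w (2 * p) := mem_of_indicatorE_lt_top hv.1
  rw [edist_comm, edist_zero_right, ← ofReal_norm,
    ENNReal.ofReal_lt_ofReal_iff (by positivity)] at hlt
  simp only [gradient_chainProblem] at hlt
  set u := chainOnes w (2 * p) with hu
  have hbound : ∀ i < 2 * p, (inner ℝ (w i) x : ℝ) ≤ c / 2 := by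
    intro i hi
    have h1 := abs_inner_le hM hS hA hx (2 * p - 1 - i) (by omega)
    rw [show 2 * p - 1 - (2 * p - 1 - i) = i by omega] at h1
    have h2 : ((2 * p - 1 - i : ℕ) : ℝ) ≤ 2 * p := by
      exact_mod_cast (by omega : 2 * p - 1 - i ≤ 2 * p)
    have h3 := mul_le_mul_of_nonneg_right h2 (div_pos hε hM).le
    linarith [le_abs_self (inner ℝ (w i) x : ℝ)]
  -- `u` lies in the kernel of the matrix and in the linked subspace, so the multiplier and the
  -- subgradient drop out.
  have hinner : inner ℝ u (L • ∑ i ∈ Finset.range p, ((inner ℝ (w i) x : ℝ) - c) • w i +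
      matAct (chainProblem w p L c M).A.transpose γ + v) =
      L * ∑ i ∈ Finset.range p, ((inner ℝ (w i) x : ℝ) - c) := by
    have h1 : inner ℝ u v = (0 : ℝ) := by
      rw [real_inner_comm]
      refine inner_eq_zero_of_mem_subdiff_indicatorE hv ?_
      simpa using hw.smul_chainOnes_mem_linkSpace 1
    have h2 : inner ℝ u (matAct (chainProblem w p L c M).A.transpose γ) = (0 : ℝ) := by
      have h := hw.matAct_pairMatrix_chainOnes (M := M) 1
      rw [one_smul] at h
      rw [inner_matAct_transpose]
      change inner ℝ (matAct (pairMatrix w p M) u) γ = (0 : ℝ)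
      rw [h, inner_zero_left]
    rw [inner_add_right, inner_add_right, h1, h2, inner_smul_right, inner_sum, add_zero, add_zero]
    congr 1
    refine Finset.sum_congr rfl fun i hi => ?_
    rw [inner_smul_right, real_inner_comm (w i) u,
      hw.inner_chainOnes (by have := Finset.mem_range.mp hi; omega), mul_one]
  have hsum : ∑ i ∈ Finset.range p, ((inner ℝ (w i) x : ℝ) - c) ≤ -(p * (c / 2)) := by
    have h := Finset.sum_le_card_nsmul (Finset.range p)
      (fun i => (inner ℝ (w i) x : ℝ) - c) (-(c / 2)) fun i hi => by
        have := hbound i (by have := Finset.mem_range.mp hi; omega)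
        linarith
    simpa using h
  have hcs := neg_le_of_abs_le (abs_real_inner_le_norm u
    (L • ∑ i ∈ Finset.range p, ((inner ℝ (w i) x : ℝ) - c) • w i +
      matAct (chainProblem w p L c M).A.transpose γ + v))
  rw [hinner] at hcs
  have hunorm : ‖u‖ ≤ 2 * Real.sqrt p := by
    refine abs_le_of_sq_le_sq' ?_ (by positivity) |>.2
    rw [hw.norm_sq_chainOnes, mul_pow, Real.sq_sqrt (by positivity)]
    push_cast
    nlinarith [(Nat.cast_nonneg p : (0 : ℝ) ≤ p)]
  have hs : 0 < Real.sqrt p := Real.sqrt_pos.mpr (by exact_mod_cast hp)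
  have hss : Real.sqrt p * Real.sqrt p = p := Real.mul_self_sqrt (by positivity)
  have h1 := mul_le_mul_of_nonneg_left hsum hL.le
  have h3 := mul_le_mul_of_nonneg_right hcp hs.le
  have h4 : L * c * Real.sqrt p * Real.sqrt p = L * c * p := by rw [mul_assoc, hss]
  have hun : 0 < ‖u‖ := by
    have h := hw.norm_sq_chainOnes
    rw [← hu] at h
    refine lt_of_le_of_ne (norm_nonneg _) fun h0 => ?_
    rw [← h0] at h
    have : (0 : ℝ) < ((2 * p : ℕ) : ℝ) := by exact_mod_cast (by omega : 0 < 2 * p)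
    simp at h
    omega
  have h5 := mul_lt_mul_of_pos_left hlt hun
  have h6 := mul_le_mul_of_nonneg_right hunorm (by positivity : 0 ≤ 2 * ε)
  -- The chain `L p c / 2 ≤ |⟨u, ·⟩| < 2 √p · 2 ε ≤ L c p / 2` is contradictory.
  nlinarith

/-! ### At most two new coordinates per call. -/

theorem OrthonormalBelow.gradient_mem_vanishFrom (hw : OrthonormalBelow w (2 * p)) {k : ℕ}
    (hk : p ≤ k) (x : Vec d) :
    gradient (chainProblem w p L c M).f₀ x ∈ vanishFrom w (2 * p) k := by
  intro i hi hki
  rw [gradient_chainProblem, inner_smul_right, hw.inner_sum_smul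
    (fun i hi => by have := Finset.mem_range.mp hi; omega) _ hi, if_neg (by simp; omega), mul_zero]

theorem OrthonormalBelow.iterate_mem_vanishFrom (hw : OrthonormalBelow w (2 * p)) (hp : Odd p)
    {x : ℕ → Vec d} (hx : (chainProblem w p L c M).IsFOM x)
    (hx0 : ∀ i < 2 * p, inner ℝ (w i) (x 0) = (0 : ℝ)) (t : ℕ) :
    x t ∈ vanishFrom w (2 * p) (p + 2 * t) := by
  induction t using Nat.strong_induction_on with
  | _ t ih =>
    rcases Nat.eq_zero_or_pos t with rfl | ht
    · exact fun i hi _ => hx0 i hi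
    obtain ⟨η, ξ, q, hη, hξ, hq, hxt⟩ := hx t ht
    rw [chainProblem_g] at hq
    -- The matrix step reaches only `p + 2 s + 1`; rounding up to `p + 2 t` restores the odd index
    -- needed for the prox.
    have hξ' : ξ ∈ vanishFrom w (2 * p) (p + 2 * t) := by
      refine Submodule.span_le.mpr ?_ hξ
      rintro v ⟨s, hs, rfl | rfl | rfl | rfl⟩
      · exact vanishFrom_mono w _ (by omega) (ih s hs)
      · exact hw.gradient_mem_vanishFrom (by omega) _
      · change matAct _ (0 : Vec p) ∈ _
        simp [matAct]
      · exact vanishFrom_mono w _ (by omega)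
          (hw.matAct_transpose_matAct_mem_vanishFrom M (ih s hs))
    refine Submodule.span_le.mpr ?_ hxt
    rintro v (rfl | rfl)
    · exact hξ'
    · exact hw.prox_mem_vanishFrom (hp.add_even (even_two_mul t)) hη hξ' hq

theorem OrthonormalBelow.knownSpan_le_vanishFrom (hw : OrthonormalBelow w (2 * p)) (hp : Odd p)
    {x0 : Vec d} (hx0 : ∀ i < 2 * p, inner ℝ (w i) x0 = (0 : ℝ)) {k : ℕ}
    {q : ℕ → OracleQuery d p} {a : ℕ → OracleAnswer d p}
    (h : (chainProblem w p L c M).IsCallSequence x0 k q a) (l : ℕ) (hl : l ≤ k) :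
    knownSpan x0 a l ≤ vanishFrom w (2 * p) (p + 2 * l) := by
  induction l using Nat.strong_induction_on with
  | _ l ih =>
    refine Submodule.span_le.mpr ?_
    rintro v (rfl | ⟨i, hi, hv⟩)
    · exact fun i hi _ => hx0 i hi
    obtain ⟨hans, hqx, hqz⟩ := h i (by omega)
    have hle := ih i hi (by omega)
    refine vanishFrom_mono w _ (by omega : p + 2 * (i + 1) ≤ p + 2 * l) ?_
    rcases hv with rfl | rfl | rfl
    · rw [hans.grad_eq]
      exact hw.gradient_mem_vanishFrom (by omega) _
    · rw [hans.Atz_eq]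
      change (q i).z ∈ (vanishFrom w (2 * p) (p + 2 * (i + 1))).comap
        (Matrix.toEuclideanLin (pairMatrix w p M).transpose)
      refine Submodule.span_le.mpr ?_ hqz
      rintro z (rfl | ⟨y, hy, rfl⟩)
      · exact Submodule.zero_mem _
      · exact vanishFrom_mono w _ (by omega)
          (hw.matAct_transpose_matAct_mem_vanishFrom M (hle hy))
    · have hprox := hans.prox_spec
      rw [chainProblem_g] at hprox
      exact vanishFrom_mono w _ (by omega)
        (hw.prox_mem_vanishFrom (hp.add_even (even_two_mul i)) (q i).η_pos (hle hqx) hprox)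

end ChainProblem

/-! ### Choice of parameters. -/

theorem claim2 (ε Lf C D : ℝ) (hε : 0 < ε) (hLf : 0 < Lf) (hC : 1 < C) :
    ∃ d : ℕ, ∀ x0 : Vec d, ∃ (n nbar : ℕ) (P : CompositeProblem d n nbar),
      P.InProblemClass Lf ∧ P.NonsmoothRegularizer ∧ P.A ≠ 0 ∧
      matAct P.A x0 + P.b = 0 ∧ P.F₀ x0 < ⊤ ∧ D ≤ P.gap x0 ∧
      (∃ y, P.IsEpsStationary ε y) ∧
      ∀ x : ℕ → Vec d, P.IsFOM x → x 0 = x0 →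
        ∀ t, P.IsEpsStationary ε (x t) →
          ⌈C * condNumber P.A * Lf * P.gap x0 * (ε ^ 2)⁻¹⌉₊ ≤ t ∧
          ∀ k, P.ProducibleWith x0 k (x t) →
            ⌈C * condNumber P.A * Lf * P.gap x0 * (ε ^ 2)⁻¹⌉₊ ≤ k := by
  -- The three terms secure, in order, the bound `8 ε ≤ Lf c √p`, a gap of at least `D`, and `K ≤
  -- K²`.
  let K : ℝ := 8 * ε / Lf + 2 * |D| / Lf + 1
  have hK1 : 1 ≤ K := by
    have h1 : 0 ≤ 8 * ε / Lf := by positivity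
    have h2 : 0 ≤ 2 * |D| / Lf := by positivity
    linarith
  have hKε : 8 * ε ≤ Lf * K := by
    have h : Lf * K = 8 * ε + 2 * |D| + Lf := by simp only [K]; field_simp
    linarith [abs_nonneg D]
  have hKD : 2 * |D| ≤ Lf * K := by
    have h : Lf * K = 8 * ε + 2 * |D| + Lf := by simp only [K]; field_simp
    linarith [abs_nonneg D]
  set N := ⌈C * 1 * Lf * (Lf / 2 * K ^ 2) * (ε ^ 2)⁻¹⌉₊ with hN
  -- Odd, at least 3, and long enough that `p + 2 s ≤ 2 p - 1` for all `s < N`.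
  obtain ⟨p, hp⟩ : ∃ p, p = 2 * (N + 1) + 1 := ⟨_, rfl⟩
  have hodd : Odd p := ⟨_, hp⟩
  have hp0 : (0 : ℝ) < p := by exact_mod_cast (by omega : 0 < p)
  have hs : 0 < Real.sqrt p := Real.sqrt_pos.mpr hp0
  have hc : 0 < K / Real.sqrt p := by positivity
  -- This scale `M` makes the accumulated error `2 p ε / M` exactly `c / 2`.
  have hM : 0 < 4 * p * ε / (K / Real.sqrt p) := by positivity
  refine ⟨2 * p + 1, fun x0 => ?_⟩
  obtain ⟨w, hw, hwx0⟩ := exists_orthonormalBelow_orthogonal rfl x0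
  have hgap : (chainProblem w p Lf (K / Real.sqrt p) (4 * p * ε / (K / Real.sqrt p))).gap x0 =
      Lf / 2 * K ^ 2 := by
    rw [hw.chainProblem_gap hLf hwx0, div_pow, Real.sq_sqrt hp0.le, mul_div_cancel₀ _ hp0.ne']
  have hcond : condNumber
      (chainProblem w p Lf (K / Real.sqrt p) (4 * p * ε / (K / Real.sqrt p))).A = 1 :=
    hw.condNumber_pairMatrix (by omega) hM
  refine ⟨p, 2 * p + 1, chainProblem w p Lf (K / Real.sqrt p) (4 * p * ε / (K / Real.sqrt p)),
    hw.chainProblem_inProblemClass (by omega) hLf, hw.chainProblem_nonsmoothRegularizer (by omega),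
    hw.pairMatrix_ne_zero (by omega) hM, ?_, ?_, ?_, ⟨_, hw.chainProblem_isEpsStationary hε⟩, ?_⟩
  · change matAct (pairMatrix w p _) x0 + 0 = 0
    rw [add_zero]
    ext j
    have hj := j.2
    rw [matAct_pairMatrix_apply, hwx0 _ (by omega), hwx0 _ (by omega)]
    simp
  · rw [chainProblem_F₀_of_orthogonal hwx0]
    exact EReal.coe_lt_top _
  · rw [hgap]
    nlinarith [le_abs_self D]
  · intro x hx hx0 t ht
    rw [hgap, hcond, ← hN]
    have hlarge : ∀ s, x t ∈ vanishFrom w (2 * p) (p + 2 * s) → N ≤ s := by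
      intro s hmem
      by_contra! hlt
      refine hw.not_isEpsStationary (by omega) hLf hε hM (le_of_eq ?_) ?_
        (vanishFrom_mono w _ (by omega) hmem) ht
      · field_simp
        ring
      · rw [mul_assoc, div_mul_cancel₀ _ hs.ne']
        exact hKε
    refine ⟨hlarge t (hw.iterate_mem_vanishFrom hodd hx (by rwa [hx0]) t), ?_⟩
    rintro k ⟨q, a, hqa, hy⟩
    exact hlarge k (hw.knownSpan_le_vanishFrom hodd hwx0 hqa k le_rfl hy)
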